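/- Write $\mathbb T^2=\mathbb R^2/\mathbb Z^2$, and let $\mathrm{Homeo}_0(\mathbb T^2)$ be the set of homeomorphisms of $\mathbb T^2$ homotopic to the identity. For $w=(a,b)\in\mathbb R^2$ put $w^{\perp}=(-b,a)$, and for $w\neq 0$ put $\mathrm{Pr}_w(x)=\langle x,w\rangle/\|w\|$. For a lift $\tilde g:\mathbb R^2\to\mathbb R^2$ of $g\in\mathrm{Homeo}_0(\mathbb T^2)$ define the deviation and the deviation in the direction $w\ne 0$ by $$\delta(\tilde g)=\sup_{n\in\mathbb Z,\;x,y\in\mathbb R^2}\bigl\|(\tilde g^n(x)-x)-(\tilde g^n(y)-y)\bigr\|,\qquad \delta_w(\tilde g)=\sup_{n\in\mathbb Z,\;x,y\in\mathbb R^2}\bigl|\mathrm{Pr}_w\bigl[(\tilde g^n(x)-x)-(\tilde g^n(y)-y)\bigr]\bigr|,$$ with values in $[0,\infty]$. For $v\in\mathbb Z^2\setminus\{0\}$, $\tilde g$ is called $v$-annular if there is $M>0$ with $|\langle \tilde g^n(x)-x,\,v^{\perp}\rangle|\le M$ for all $x\in\mathbb R^2$ and $n\in\mathbb Z$. The rotation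 set $\rho(\tilde g)$ is the set of all limits $\lim_i(\tilde g^{n_i}(x_i)-x_i)/n_i$ with $x_i\in\mathbb R^2$, $n_i\in\mathbb Z$ and $n_i\to+\infty$; $\tilde g$ is a pseudo-rotation if $\rho(\tilde g)$ is a single point. **Theorem B.** Let $f,h\in\mathrm{Homeo}_0(\mathbb T^2)$ commute, and let $\tilde f,\tilde h$ be lifts of $f$ and $h$, respectively. If $\tilde f$ is $v$-annular for some $v\in\mathbb Z^2\setminus\{0\}$, then $\delta_{v^{\perp}}(\tilde h)<\infty$, or $\delta(\tilde f)<\infty$ and (hence) $\tilde f$ is a pseudo-rotation. -/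

import Mathlib

open scoped ENNReal

namespace TorusHomeo

noncomputable section

/-- The Euclidean plane. -/
abbrev Plane : Type := EuclideanSpace ℝ (Fin 2)

/-- The two-dimensional torus `ℝ² / ℤ²`. -/
abbrev Torus : Type := UnitAddTorus (Fin 2)

/-- The canonical projection of the plane onto the torus. -/
def proj (x : Plane) : Torus := fun i => ((x i : ℝ) : UnitAddCircle)

/-- `f` belongs to `Homeo₀(𝕋²)`: it is a homeomorphism of the torus homotopic to the identity. -/
def HomotopicToId (f : Torus ≃ₜ Torus) : Prop :=
  ContinuousMap.Homotopic (f : C(Torus, Torus)) (ContinuousMap.id Torus)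

/-- `F` is a lift of `f` to the plane. -/
def IsLift (F : Plane ≃ₜ Plane) (f : Torus ≃ₜ Torus) : Prop :=
  ∀ x : Plane, proj (F x) = f (proj x)

/-- An integer vector, seen in the plane. -/
def intVec (v : Fin 2 → ℤ) : Plane := !₂[(v 0 : ℝ), (v 1 : ℝ)]

/-- `(a, b)^⊥ = (-b, a)`. -/
def perp (v : Plane) : Plane := !₂[-(v 1), v 0]

/-- The scalar orthogonal projection `x ↦ ⟨x, v⟩ / ‖v‖`. -/
def scalarProj (v x : Plane) : ℝ := inner ℝ x v / ‖v‖

/-- The displacement `F ^ n (x) - x`, for an integer `n` (powers are iterates). -/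
def disp (F : Plane ≃ₜ Plane) (n : ℤ) (x : Plane) : Plane := (F ^ n) x - x

/-- The deviation of `F`, a supremum in `[0, ∞]`. -/
def deviation (F : Plane ≃ₜ Plane) : ℝ≥0∞ :=
  ⨆ (n : ℤ) (x : Plane) (y : Plane), ‖disp F n x - disp F n y‖ₑ

/-- The deviation of `F` in the direction `v`, a supremum in `[0, ∞]`. -/
def deviationIn (v : Plane) (F : Plane ≃ₜ Plane) : ℝ≥0∞ :=
  ⨆ (n : ℤ) (x : Plane) (y : Plane), ‖scalarProj v (disp F n x - disp F n y)‖ₑ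

/-- `F` is `v`-annular: its iterates have uniformly bounded displacement in the direction
orthogonal to `v`. (Being `u^⊥`-annular means bounded displacement along `u`; for `v = u^⊥` one
has `u = -v^⊥`, and the sign is irrelevant.) -/
def IsAnnular (v : Plane) (F : Plane ≃ₜ Plane) : Prop :=
  ∃ M : ℝ, ∀ (n : ℤ) (x : Plane), |inner ℝ (disp F n x) (perp v)| ≤ M

/-- The rotation set of `F` (Misiurewicz and Ziemian): all limits of
`(F ^ nᵢ (xᵢ) - xᵢ) / nᵢ` with `nᵢ → +∞`. -/
def rotationSet (F : Plane ≃ₜ Plane) : Set Plane :=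
  {p | ∃ (n : ℕ → ℤ) (x : ℕ → Plane), Filter.Tendsto n Filter.atTop Filter.atTop ∧
    Filter.Tendsto (fun i => ((n i : ℝ)⁻¹) • disp F (n i) (x i)) Filter.atTop (nhds p)}

/-- `F` is a pseudo-rotation: its rotation set is a single point. -/
def IsPseudoRotation (F : Plane ≃ₜ Plane) : Prop :=
  ∃ p : Plane, rotationSet F = {p}

end

end TorusHomeo

/-! ### Crossing of planar paths -/

namespace TorusHomeo

open Set unitInterval

/-! Let `u` be the height along v^⊥ and `s` the coordinate along v; annularity means that every
power of `F` changes heights by at most some `M`. Suppose the v^⊥-deviation of `H` is infinite. Then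
some power `G` of `H`, after integral translations, sends a point `x` of height at most 0 far above
the image of a point `y` of height greater than `M`.

The upward ray from `y` stays above height 0 under every `F ^ k`, so it never meets the downward ray
from `x` or its horizontal translates. Applying `G`, which commutes with `F`, gives curves γ, rising
from a low point, and κ, descending from a high one, such that `F ^ k` γ misses all translates of κ.
In a strip between their endpoints these translates are barriers, so an arc of γ crossing the strip
has images of width bounded independently of `k` (`width_le_of_disjoint`).

Such an arc controls a whole square: if the image of a segment in the square were very wide, it
would cross many translates of the image of the arc, and undoing `F ^ k` the segment itself would
meet many translates of a fixed compact arc (`square_spread_le`). Translating the square bounds the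
deviation of `F` along v; annularity bounds the other direction. -/

/-- A continuous real function on the unit interval that avoids `c` stays on one side of it. -/
lemma lt_of_continuous_of_ne {θ : I → ℝ} (hθ : Continuous θ) {c : ℝ} (hne : ∀ t, θ t ≠ c) {a b : I}
    (ha : θ a < c) : θ b < c := by
  by_contra! hb
  obtain ⟨t, ht⟩ := mem_range_of_exists_le_of_exists_ge hθ ⟨a, ha.le⟩ ⟨b, hb⟩
  exact hne t ht

/-- Two paths in a rectangle, one joining the vertical sides and the other the horizontal sides,
intersect. -/
theorem exists_crossing_unitInterval {a₁ a₂ b₁ b₂ : I → ℝ}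
    (ha₁ : Continuous a₁) (ha₂ : Continuous a₂) (hb₁ : Continuous b₁) (hb₂ : Continuous b₂)
    (hl : ∀ t, a₁ 0 < b₁ t) (hr : ∀ t, b₁ t < a₁ 1)
    (hd : ∀ t, b₂ 0 < a₂ t) (hu : ∀ t, a₂ t < b₂ 1) :
    ∃ s t, a₁ s = b₁ t ∧ a₂ s = b₂ t := by
  by_contra! hne
  let z : I × I → ℂ := fun p => ⟨a₁ p.1 - b₁ p.2, a₂ p.1 - b₂ p.2⟩
  have hz : Continuous z := by
    have : z = fun p => ((a₁ p.1 - b₁ p.2 : ℝ) : ℂ) + ((a₂ p.1 - b₂ p.2 : ℝ) : ℂ) * Complex.I := by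
      ext p
      exact Complex.mk_eq_add_mul_I _ _
    rw [this]
    fun_prop
  have hz0 : ∀ p, z p ≠ 0 := fun p hp => hne p.1 p.2
    (sub_eq_zero.1 (congrArg Complex.re hp)) (sub_eq_zero.1 (congrArg Complex.im hp))
  let Z : C(I × I, {z : ℂ // z ≠ 0}) := ⟨fun p => ⟨z p, hz0 p⟩, by fun_prop⟩
  -- On the left side `z` has negative real part, so `-z` avoids the cut of the logarithm; adding πi
  -- puts the angle in (π/2, 3π/2).
  let l : C(I, ℂ) := ⟨fun t => Complex.log (-z (0, t)) + Real.pi * Complex.I, by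
    refine Continuous.add (Continuous.clog (by fun_prop) fun t => ?_) continuous_const
    left
    simpa [z] using hl t⟩
  have hZ0 : ∀ t, Z (0, t) = ⟨Complex.exp (l t), Complex.exp_ne_zero _⟩ := by
    intro t
    apply Subtype.ext
    simp only [Z, l, ContinuousMap.coe_mk]
    rw [Complex.exp_add, Complex.exp_log (neg_ne_zero.2 (hz0 _)), Complex.exp_pi_mul_I]
    ring
  let g := Complex.isCoveringMap_exp.liftHomotopy Z l hZ0
  have hg : ∀ p, Complex.exp (g p) = z p := fun p =>
    congrArg Subtype.val (congrFun (Complex.isCoveringMap_exp.liftHomotopy_lifts Z l hZ0) p)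
  have hg0 : ∀ t, g (0, t) = l t := Complex.isCoveringMap_exp.liftHomotopy_zero Z l hZ0
  let θ : I × I → ℝ := fun p => (g p).im
  have hθ : Continuous θ := Complex.continuous_im.comp g.continuous
  have hcos : ∀ p, 0 < (z p).re ↔ 0 < Real.cos (θ p) := fun p => by
    rw [← hg p, Complex.exp_re]
    exact mul_pos_iff_of_pos_left (Real.exp_pos _)
  have hsin : ∀ p, 0 < (z p).im ↔ 0 < Real.sin (θ p) := fun p => by
    rw [← hg p, Complex.exp_im]
    exact mul_pos_iff_of_pos_left (Real.exp_pos _)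
  have hsin' : ∀ p, (z p).im < 0 → Real.sin (θ p) < 0 := fun p hp => by
    rw [← hg p, Complex.exp_im] at hp
    exact lt_of_mul_lt_mul_left (by simpa using hp) (Real.exp_pos _).le
  have hleft : ∀ t, Real.pi / 2 < θ (0, t) ∧ θ (0, t) < 3 * Real.pi / 2 := by
    intro t
    have hre : 0 < (-z (0, t)).re := by simpa [z] using hl t
    have h := abs_lt.1 (Complex.abs_arg_lt_pi_div_two_iff.2 (Or.inl hre))
    have : θ (0, t) = (-z (0, t)).arg + Real.pi := by
      simp [θ, hg0, l, Complex.log_im]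
    constructor <;> linarith
  have hbot : ∀ s, 0 < Real.sin (θ (s, 0)) := fun s => (hsin _).1 (sub_pos.2 (hd s))
  have htop : ∀ s, Real.sin (θ (s, 1)) < 0 := fun s => hsin' _ (sub_neg.2 (hu s))
  have hright : ∀ t, 0 < Real.cos (θ (1, t)) := fun t => (hcos _).1 (sub_pos.2 (hr t))
  have hpi := Real.pi_pos
  -- The angle starts below π at the bottom left corner and cannot reach π along the bottom, where
  -- its sine is positive. The top side is symmetric, so the right side would have to pass through
  -- π, where the cosine is negative.
  have h10 : θ (1, 0) < Real.pi := by
    refine lt_of_continuous_of_ne (θ := fun s => θ (s, 0)) (by fun_prop) (a := 0) ?_ ?_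
    · intro s hs
      have := hbot s
      simp_all
    · by_contra! h
      have := Real.sin_nonneg_of_nonneg_of_le_pi (x := θ (0, 0) - Real.pi) (by linarith)
        (by linarith [(hleft 0).2])
      rw [Real.sin_sub_pi] at this
      linarith [hbot 0]
  have h11 : Real.pi < θ (1, 1) := by
    have : -θ (1, 1) < -Real.pi := by
      refine lt_of_continuous_of_ne (θ := fun s => -θ (s, 1)) (by fun_prop) (a := 0) ?_ ?_
      · intro s hs
        have := htop s
        have h' : θ (s, 1) = Real.pi := by linarith
        simp [h'] at this
      · by_contra! h
        have := Real.sin_nonneg_of_nonneg_of_le_pi (x := θ (0, 1)) (by linarith [(hleft 1).1])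
          (by linarith)
        linarith [htop 0]
    linarith
  refine h11.not_gt (lt_of_continuous_of_ne (θ := fun t => θ (1, t)) (by fun_prop) (a := 0) ?_ h10)
  intro t ht
  have := hright t
  rw [ht, Real.cos_pi] at this
  linarith

/-- Crossing of two paths in a rectangle, for paths with arbitrary parameter intervals. -/
theorem exists_crossing {a₁ a₂ b₁ b₂ : ℝ → ℝ}
    (ha₁ : Continuous a₁) (ha₂ : Continuous a₂) (hb₁ : Continuous b₁) (hb₂ : Continuous b₂)
    {p q r w : ℝ}
    (hl : ∀ t ∈ uIcc r w, a₁ p < b₁ t) (hr : ∀ t ∈ uIcc r w, b₁ t < a₁ q)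
    (hd : ∀ t ∈ uIcc p q, b₂ r < a₂ t) (hu : ∀ t ∈ uIcc p q, a₂ t < b₂ w) :
    ∃ s ∈ uIcc p q, ∃ t ∈ uIcc r w, a₁ s = b₁ t ∧ a₂ s = b₂ t := by
  have hmem : ∀ (x y : ℝ) (t : I), x + t * (y - x) ∈ uIcc x y := by
    intro x y t
    rw [← segment_eq_uIcc, segment_eq_image']
    exact ⟨t, t.2, by simp⟩
  obtain ⟨s, t, h⟩ := exists_crossing_unitInterval
    (a₁ := fun t => a₁ (p + t * (q - p))) (a₂ := fun t => a₂ (p + t * (q - p)))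
    (b₁ := fun t => b₁ (r + t * (w - r))) (b₂ := fun t => b₂ (r + t * (w - r)))
    (by fun_prop) (by fun_prop) (by fun_prop) (by fun_prop)
    (fun t => by simpa using hl _ (hmem r w t)) (fun t => by simpa using hr _ (hmem r w t))
    (fun t => by simpa using hd _ (hmem p q t)) (fun t => by simpa using hu _ (hmem p q t))
  exact ⟨_, hmem p q s, _, hmem r w t, h⟩

/-- A continuous function going from below `a` to above `b` has a passage from `a` to `b` during
which it stays in `[a, b]`. -/
lemma exists_passage {g : ℝ → ℝ} (hg : Continuous g) {a b p q : ℝ} (hab : a ≤ b) (hpq : p ≤ q)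
    (hp : g p ≤ a) (hq : b ≤ g q) :
    ∃ t₀ t₁, p ≤ t₀ ∧ t₀ ≤ t₁ ∧ g t₀ = a ∧ g t₁ = b ∧ ∀ t ∈ Icc t₀ t₁, g t ∈ Icc a b := by
  -- `t₀` is the last time in `[p, q]` with `g ≤ a`, and `t₁` the first time after it with `g ≥ b`.
  have hc : IsCompact (Icc p q ∩ g ⁻¹' Iic a) := isCompact_Icc.inter_right (isClosed_Iic.preimage hg)
  obtain ⟨t₀, ⟨⟨h0p, h0q⟩, h0a⟩, h0max⟩ := hc.exists_isGreatest ⟨p, ⟨le_rfl, hpq⟩, hp⟩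
  have hc' : IsCompact (Icc t₀ q ∩ g ⁻¹' Ici b) :=
    isCompact_Icc.inter_right (isClosed_Ici.preimage hg)
  obtain ⟨t₁, ⟨⟨h1p, h1q⟩, h1b⟩, h1min⟩ := hc'.exists_isLeast ⟨q, ⟨h0q, le_rfl⟩, hq⟩
  simp only [mem_preimage, mem_Iic, mem_Ici] at h0a h1b
  have hge : ∀ t ∈ Icc t₀ t₁, a ≤ g t := by
    intro t ht
    by_contra! hlt
    obtain ⟨t', ht', hgt'⟩ := intermediate_value_Icc (h1q.trans' ht.2) hg.continuousOn
      (show a ∈ Icc (g t) (g q) from ⟨hlt.le, hab.trans hq⟩)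
    have h1 := h0max ⟨⟨h0p.trans (ht.1.trans ht'.1), ht'.2⟩, hgt'.le⟩
    have : t = t' := le_antisymm ht'.1 (h1.trans ht.1)
    subst this
    linarith
  have hle : ∀ t ∈ Icc t₀ t₁, g t ≤ b := by
    intro t ht
    by_contra! hlt
    obtain ⟨t', ht', hgt'⟩ := intermediate_value_Icc ht.1 hg.continuousOn
      (show b ∈ Icc (g t₀) (g t) from ⟨h0a.trans hab, hlt.le⟩)
    have h1 := h1min ⟨⟨ht'.1, ht'.2.trans (ht.2.trans h1q)⟩, hgt'.ge⟩
    have : t = t' := le_antisymm (ht.2.trans h1) ht'.2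
    subst this
    linarith
  exact ⟨t₀, t₁, h0p, h1p, le_antisymm h0a (hge _ ⟨le_rfl, h1p⟩),
    le_antisymm (hle _ ⟨h1p, le_rfl⟩) h1b, fun t ht => ⟨hge t ht, hle t ht⟩⟩

end TorusHomeo

/-! ### The dichotomy in abstract coordinates -/

namespace TorusHomeo

open Set

section Abstract

variable {E : Type*} [NormedAddCommGroup E] [NormedSpace ℝ E]

lemma zpow_apply_add_smul {F : E ≃ₜ E} {e : E} (hF : ∀ x, F (x + e) = F x + e) (n j : ℤ) (x : E) :
    (F ^ n) (x + (j : ℝ) • e) = (F ^ n) x + (j : ℝ) • e := by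
  have hT : ∀ (j : ℤ) (x : E), ((Homeomorph.addRight e) ^ j) x = x + (j : ℝ) • e := by
    have hnat : ∀ (j : ℕ) (x : E), ((Homeomorph.addRight e) ^ j) x = x + (j : ℝ) • e := by
      intro j
      induction j with
      | zero => intro x; simp
      | succ j ih =>
        intro x
        rw [pow_succ', Homeomorph.mul_apply, ih, Homeomorph.coe_addRight]
        push_cast
        module
    intro j x
    obtain ⟨k, rfl | rfl⟩ := j.eq_nat_or_neg
    · simpa using hnat k x
    · have h := hnat k (x + (((-(k : ℤ) : ℤ)) : ℝ) • e)
      have h' : x + (((-(k : ℤ) : ℤ)) : ℝ) • e + (k : ℝ) • e = x := by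
        push_cast
        module
      rw [h'] at h
      rw [← h, zpow_neg, zpow_natCast, ← Homeomorph.mul_apply, inv_mul_cancel, h]
      rfl
  have hc : Commute F (Homeomorph.addRight e) := by
    ext x
    exact hF x
  have := congrArg (fun K : E ≃ₜ E => K x) ((hc.zpow_zpow n j).eq)
  simpa only [Homeomorph.mul_apply, hT] using this

variable {s u : E →L[ℝ] ℝ} {e₁ e₂ : E} (hs₁ : s e₁ = 1) (hs₂ : s e₂ = 0) (hu₁ : u e₁ = 0)
  (hu₂ : u e₂ = 1) (hinj : ∀ x y, s x = s y → u x = u y → x = y) {F : E ≃ₜ E}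
  (hF₁ : ∀ x, F (x + e₁) = F x + e₁) (hF₂ : ∀ x, F (x + e₂) = F x + e₂)
  {M : ℝ} (hM : ∀ (n : ℤ) (x : E), |u ((F ^ n) x - x)| ≤ M)

include hs₁ hs₂ hu₁ hu₂ hF₁ hF₂ in
/-- A bound on the spread of the iterates of a unit square bounds the deviation. -/
lemma exists_forall_sub_le_of_square {m C : ℝ}
    (hC : ∀ (k : ℤ) (x z : E), s x ∈ Icc 0 1 → u x ∈ Icc m (m + 1) → s z ∈ Icc 0 1 →
      u z ∈ Icc m (m + 1) → s ((F ^ k) z) - s ((F ^ k) x) ≤ C) (k : ℤ) (x z : E) :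
    s ((F ^ k) z - z) - s ((F ^ k) x - x) ≤ C + 1 := by
  have key : ∀ x : E, ∃ x', s x' ∈ Icc 0 1 ∧ u x' ∈ Icc m (m + 1) ∧
      s ((F ^ k) x - x) = s ((F ^ k) x') - s x' := by
    intro x
    refine ⟨x + ((⌈-s x⌉ : ℤ) : ℝ) • e₁ + ((⌈m - u x⌉ : ℤ) : ℝ) • e₂, ?_, ?_, ?_⟩
    · have h1 := Int.le_ceil (-s x)
      have h2 := Int.ceil_lt_add_one (-s x)
      simp only [map_add, map_smul, hs₁, hs₂, smul_eq_mul, mul_one, mul_zero, mem_Icc]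
      constructor <;> linarith
    · have h1 := Int.le_ceil (m - u x)
      have h2 := Int.ceil_lt_add_one (m - u x)
      simp only [map_add, map_smul, hu₁, hu₂, smul_eq_mul, mul_one, mul_zero, mem_Icc]
      constructor <;> linarith
    · rw [zpow_apply_add_smul hF₂, zpow_apply_add_smul hF₁]
      simp only [map_add, map_sub]
      ring
  obtain ⟨x', hx1, hx2, hx3⟩ := key x
  obtain ⟨z', hz1, hz2, hz3⟩ := key z
  rw [hx3, hz3]
  linarith [hC k x' z' hx1 hx2 hz1 hz2, hx1.2, hz1.1]

include hs₁ hu₁ hinj hF₁ hM in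
/-- If all the iterates of an arc crossing a strip have bounded width, so do all the iterates of
a smaller unit square. -/
lemma square_spread_le {γ : ℝ → E} (hγ : Continuous γ) {t₀ t₁ m D : ℝ}
    (h₀ : u (γ t₀) < m - 2 * M) (h₁ : m + 1 + 2 * M < u (γ t₁))
    (hD : ∀ k : ℤ, ∀ t ∈ uIcc t₀ t₁, ∀ t' ∈ uIcc t₀ t₁,
      s ((F ^ k) (γ t')) - s ((F ^ k) (γ t)) ≤ D) :
    ∃ C, ∀ (k : ℤ) (x z : E), s x ∈ Icc 0 1 → u x ∈ Icc m (m + 1) → s z ∈ Icc 0 1 →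
      u z ∈ Icc m (m + 1) → s ((F ^ k) z) - s ((F ^ k) x) ≤ C := by
  obtain ⟨C, hC⟩ := (isCompact_uIcc (a := t₀) (b := t₁)).exists_bound_of_continuousOn
    (f := fun t => s (γ t)) (by fun_prop)
  -- A larger spread leaves room for two barriers whose indices differ by at least `2 * C + 2`,
  -- while `hcross` confines indices to an interval of length `2 * C + 1`.
  refine ⟨2 * D + 1 + (⌈2 * C⌉₊ + 2 : ℕ), fun k x z hsx hux hsz huz => ?_⟩
  by_contra! hlt
  set c := s ((F ^ k) (γ t₀))
  have hcγ : ∀ t ∈ uIcc t₀ t₁, c - D ≤ s ((F ^ k) (γ t)) ∧ s ((F ^ k) (γ t)) ≤ c + D :=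
    fun t ht => ⟨by linarith [hD k t ht t₀ left_mem_uIcc], by linarith [hD k t₀ left_mem_uIcc t ht]⟩
  have hF : ∀ y, u y - M ≤ u ((F ^ k) y) ∧ u ((F ^ k) y) ≤ u y + M := fun y => by
    have := abs_le.1 (hM k y)
    rw [map_sub] at this
    constructor <;> linarith
  have hcont : Continuous (F ^ k) := (F ^ k).continuous
  -- The image of the segment from `x` to `z` crosses the `j`-th translate of the image arc. Undoing
  -- `F ^ k`, the segment meets the translate of γ itself, which limits `j`.
  have hcross : ∀ j : ℤ, s ((F ^ k) x) < c - D + j → c + D + j < s ((F ^ k) z) →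
      -C ≤ (j : ℝ) ∧ (j : ℝ) ≤ C + 1 := by
    intro j hj hj'
    have hσ : ∀ τ ∈ uIcc (0 : ℝ) 1, s (x + τ • (z - x)) ∈ Icc 0 1 ∧
        u (x + τ • (z - x)) ∈ Icc m (m + 1) := by
      intro τ hτ
      rw [uIcc_of_le zero_le_one] at hτ
      have hτ' : (1 - τ) + τ = 1 := by ring
      have e1 : ∀ l : E →L[ℝ] ℝ, l (x + τ • (z - x)) = (1 - τ) • l x + τ • l z := fun l => by
        simp only [map_add, map_smul, map_sub, smul_eq_mul]
        ring
      rw [e1, e1]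
      exact ⟨convex_Icc _ _ hsx hsz (by linarith [hτ.2]) hτ.1 hτ',
        convex_Icc _ _ hux huz (by linarith [hτ.2]) hτ.1 hτ'⟩
    obtain ⟨τ, hτ, t, ht, h1, h2⟩ := exists_crossing
      (a₁ := fun τ => s ((F ^ k) (x + τ • (z - x)))) (a₂ := fun τ => u ((F ^ k) (x + τ • (z - x))))
      (b₁ := fun t => s ((F ^ k) (γ t)) + j) (b₂ := fun t => u ((F ^ k) (γ t)))
      (p := 0) (q := 1) (r := t₀) (w := t₁)
      (by fun_prop) (by fun_prop) (by fun_prop) (by fun_prop)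
      (fun t ht => by simpa using (by linarith [(hcγ t ht).1] : s ((F ^ k) x) < _))
      (fun t ht => by simpa using (by linarith [(hcγ t ht).2] : _ < s ((F ^ k) z)))
      (fun τ hτ => by
        show u ((F ^ k) (γ t₀)) < u ((F ^ k) (x + τ • (z - x)))
        linarith [(hF (γ t₀)).2, (hF (x + τ • (z - x))).1, (hσ τ hτ).2.1])
      (fun τ hτ => by
        show u ((F ^ k) (x + τ • (z - x))) < u ((F ^ k) (γ t₁))
        linarith [(hF (γ t₁)).1, (hF (x + τ • (z - x))).2, (hσ τ hτ).2.2])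
    have heq : (F ^ k) (x + τ • (z - x)) = (F ^ k) (γ t + (j : ℝ) • e₁) := by
      rw [zpow_apply_add_smul hF₁]
      apply hinj
      · simpa [hs₁] using h1
      · simpa [hu₁] using h2
    have hs := congrArg s ((F ^ k).injective heq)
    rw [map_add s (γ t), map_smul, hs₁, smul_eq_mul, mul_one] at hs
    have h3 := abs_le.1 (hC t ht)
    have h4 := (hσ τ hτ).1
    rw [hs] at h4
    constructor <;> linarith [h4.1, h4.2]
  set j := ⌊s ((F ^ k) x) - c + D⌋ + 1 with hj
  have hj1 : s ((F ^ k) x) - c + D < j := by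
    rw [hj]
    push_cast
    exact Int.lt_floor_add_one _
  have hj2 : (j : ℝ) ≤ s ((F ^ k) x) - c + D + 1 := by
    rw [hj]
    push_cast
    linarith [Int.floor_le (s ((F ^ k) x) - c + D)]
  have hN : 2 * C ≤ (⌈2 * C⌉₊ : ℝ) := Nat.le_ceil _
  have hN0 : (0 : ℝ) ≤ (⌈2 * C⌉₊ : ℝ) := Nat.cast_nonneg _
  push_cast at hlt
  have hA := hcross j (by linarith) (by linarith)
  have hB := hcross (j + (⌈2 * C⌉₊ + 2 : ℕ)) (by push_cast; linarith) (by push_cast; linarith)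
  push_cast at hB
  linarith [hA.1, hB.2]

include hs₁ hu₁ hinj in
/-- A path in a strip that avoids all the translates of an arc crossing the strip is at most as
wide as the arc, up to a constant. -/
lemma width_le_of_disjoint {κ α : ℝ → E} (hκ : Continuous κ) (hα : Continuous α) {r₀ r₁ C : ℝ}
    (hC : ∀ r ∈ uIcc r₀ r₁, |s (κ r)| ≤ C) {t t' : ℝ}
    (hd : ∀ τ ∈ uIcc t t', u (κ r₀) < u (α τ)) (hu : ∀ τ ∈ uIcc t t', u (α τ) < u (κ r₁))
    (hdisj : ∀ τ ∈ uIcc t t', ∀ r ∈ uIcc r₀ r₁, ∀ j : ℤ, α τ ≠ κ r + (j : ℝ) • e₁) :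
    s (α t') - s (α t) ≤ 2 * C + 2 := by
  by_contra! hlt
  -- The first translate of κ lying strictly to the right of `α t`; it ends before `s (α t) + 2 * C
  -- + 2`.
  set j := ⌊s (α t) + C⌋ + 1 with hj
  have hj1 : s (α t) + C < j := by
    rw [hj]
    push_cast
    exact Int.lt_floor_add_one _
  have hj2 : (j : ℝ) ≤ s (α t) + C + 1 := by
    rw [hj]
    push_cast
    linarith [Int.floor_le (s (α t) + C)]
  obtain ⟨τ, hτ, r, hr, h1, h2⟩ := exists_crossing
    (a₁ := fun τ => s (α τ)) (a₂ := fun τ => u (α τ)) (b₁ := fun r => s (κ r) + j)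
    (b₂ := fun r => u (κ r)) (by fun_prop) (by fun_prop) (by fun_prop) (by fun_prop)
    (fun r hr => by linarith [(abs_le.1 (hC r hr)).1])
    (fun r hr => by linarith [(abs_le.1 (hC r hr)).2]) hd hu
  refine hdisj τ hτ r hr j (hinj _ _ ?_ ?_)
  · simpa [hs₁] using h1
  · simpa [hu₁] using h2

include hs₁ hs₂ hu₁ hu₂ hinj hF₁ hF₂ hM in
/-- If some homeomorphism commuting with `F` exchanges the heights of two points by a large amount,
then the horizontal deviation of `F` is bounded. -/
lemma exists_forall_sub_le_of_exchange {G : E ≃ₜ E}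
    (hG₁ : ∀ x, G (x + e₁) = G x + e₁) (hG₂ : ∀ x, G (x + e₂) = G x + e₂)
    (hFG : ∀ (k : ℤ) (x : E), (F ^ k) (G x) = G ((F ^ k) x)) {x y : E} (hx : u x ≤ 0) (hy : M < u y)
    (hxy : u (G y) + 6 * M + 5 ≤ u (G x)) :
    ∃ C, ∀ (k : ℤ) (x z : E), s ((F ^ k) z - z) - s ((F ^ k) x - x) ≤ C := by
  have hM0 : 0 ≤ M := (abs_nonneg _).trans (hM 0 0)
  have hG1 : ∀ (j : ℤ) (p : E), G (p + (j : ℝ) • e₁) = G p + (j : ℝ) • e₁ := fun j p => by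
    simpa using zpow_apply_add_smul hG₁ 1 j p
  have hG2 : ∀ (j : ℤ) (p : E), G (p + (j : ℝ) • e₂) = G p + (j : ℝ) • e₂ := fun j p => by
    simpa using zpow_apply_add_smul hG₂ 1 j p
  have hFu : ∀ (k : ℤ) (y : E), u y - M ≤ u ((F ^ k) y) ∧ u ((F ^ k) y) ≤ u y + M := fun k y => by
    have := abs_le.1 (hM k y)
    rw [map_sub] at this
    constructor <;> linarith
  have hGc : Continuous G := G.continuous
  let γ : ℝ → E := fun t => G (y + t • e₂)
  let κ : ℝ → E := fun t => G (x + t • e₂)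
  have hγ : Continuous γ := by fun_prop
  have hκ : Continuous κ := by fun_prop
  have hdisj : ∀ (k : ℤ) (t : ℝ), 0 ≤ t → ∀ r : ℝ, r ≤ 0 → ∀ j : ℤ,
      (F ^ k) (γ t) ≠ κ r + (j : ℝ) • e₁ := by
    intro k t ht r hr j heq
    simp only [γ, κ] at heq
    rw [hFG, ← hG1] at heq
    have h := congrArg u (G.injective heq)
    have h' := (hFu k (y + t • e₂)).1
    simp only [map_add, map_smul, hu₁, hu₂, smul_eq_mul, mul_one, mul_zero] at h h'
    linarith
  -- The arc of γ will occupy heights from `u (G y) + M + 1` to `u (G y) + 5 * M + 4`. Its images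
  -- then lie between `u (G y) + 1` and `u (G y) + 6 * M + 4`, below the top `u (G x)` of κ.
  set m := u (G y) + 3 * M + 2 with hm
  have hγu : ∀ j : ℤ, u (γ j) = u (G y) + j := fun j => by
    simp [γ, hG2, hu₂]
  have hκu : ∀ j : ℤ, u (κ j) = u (G x) + j := fun j => by
    simp [κ, hG2, hu₂]
  obtain ⟨N, hN⟩ := exists_nat_ge (4 * M + 10 + |u (G x) - u (G y)|)
  have hN1 := le_abs_self (u (G x) - u (G y))
  have hN2 := abs_nonneg (u (G x) - u (G y))
  obtain ⟨t₀, t₁, ht0, ht01, h0, h1, hmem⟩ := exists_passage (g := fun t => u (γ t)) (by fun_prop)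
    (a := m - 2 * M - 1) (b := m + 2 * M + 2) (p := 0) (q := (N : ℤ))
    (by linarith) (by simp)
    (by have := hγu 0; simp only [Int.cast_zero, add_zero] at this; rw [this]; linarith)
    (by rw [hγu]; push_cast; linarith)
  have hκ1 : u (κ 0) = u (G x) := by simpa using hκu 0
  have hκ0 : u (κ ((-(N : ℤ) : ℤ) : ℝ)) = u (G x) - N := by
    rw [hκu]
    push_cast
    ring
  have hr0 : (((-(N : ℤ) : ℤ)) : ℝ) ≤ 0 := by simp
  obtain ⟨C, hC⟩ := (isCompact_uIcc (a := (((-(N : ℤ) : ℤ)) : ℝ)) (b := 0)).exists_bound_of_continuousOn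
    (f := fun t => s (κ t)) (by fun_prop)
  have hD : ∀ k : ℤ, ∀ t ∈ uIcc t₀ t₁, ∀ t' ∈ uIcc t₀ t₁,
      s ((F ^ k) (γ t')) - s ((F ^ k) (γ t)) ≤ 2 * C + 2 := by
    intro k t ht t' ht'
    have hFc : Continuous (F ^ k) := (F ^ k).continuous
    have hsub : ∀ τ ∈ uIcc t t', τ ∈ Icc t₀ t₁ := fun τ hτ => by
      rw [← uIcc_of_le ht01]
      exact uIcc_subset_uIcc ht ht' hτ
    refine width_le_of_disjoint hs₁ hu₁ hinj hκ (α := fun t => (F ^ k) (γ t)) (by fun_prop) hC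
      ?_ ?_ ?_
    · intro τ hτ
      rw [hκ0]
      linarith [(hFu k (γ τ)).1, (hmem τ (hsub τ hτ)).1]
    · intro τ hτ
      rw [hκ1]
      linarith [(hFu k (γ τ)).2, (hmem τ (hsub τ hτ)).2]
    · intro τ hτ r hr j
      rw [uIcc_of_le hr0] at hr
      exact hdisj k τ (ht0.trans (hsub τ hτ).1) r hr.2 j
  obtain ⟨C', hC'⟩ := square_spread_le hs₁ hu₁ hinj hF₁ hM hγ (t₀ := t₀) (t₁ := t₁) (m := m)
    (by linarith) (by linarith) hD
  exact ⟨C' + 1, exists_forall_sub_le_of_square hs₁ hs₂ hu₁ hu₂ hF₁ hF₂ hC'⟩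

include hs₁ hs₂ hu₁ hu₂ hinj hF₁ hF₂ hM in
/-- If `F` has bounded vertical displacement and commutes with `H`, then `H` has bounded vertical
deviation or `F` has bounded horizontal deviation. -/
theorem vertical_or_horizontal_deviation_bounded {H : E ≃ₜ E}
    (hH₁ : ∀ x, H (x + e₁) = H x + e₁) (hH₂ : ∀ x, H (x + e₂) = H x + e₂) (hFH : Commute F H) :
    (∃ L, ∀ (n : ℤ) (x y : E), u ((H ^ n) x - x) - u ((H ^ n) y - y) ≤ L) ∨
      ∃ C, ∀ (n : ℤ) (x y : E), s ((F ^ n) x - x) - s ((F ^ n) y - y) ≤ C := by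
  rw [or_iff_not_imp_left]
  intro hL
  push Not at hL
  -- The translated points have heights in (-1, 0] and (M, M + 1], which costs at most `M + 2` of
  -- the gap.
  obtain ⟨n, x, y, hxy⟩ := hL (7 * M + 8)
  let x' := x + ((⌊-u x⌋ : ℤ) : ℝ) • e₂
  let y' := y + ((⌊M - u y⌋ + 1 : ℤ) : ℝ) • e₂
  have hx1 := Int.floor_le (-u x)
  have hx2 := Int.lt_floor_add_one (-u x)
  have hy1 := Int.floor_le (M - u y)
  have hy2 := Int.lt_floor_add_one (M - u y)
  have ht : ∀ {e : E}, (∀ x, H (x + e) = H x + e) → ∀ x, (H ^ n) (x + e) = (H ^ n) x + e :=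
    fun he x => by simpa using zpow_apply_add_smul he n 1 x
  obtain ⟨C, hC⟩ := exists_forall_sub_le_of_exchange hs₁ hs₂ hu₁ hu₂ hinj hF₁ hF₂ hM
    (ht hH₁) (ht hH₂) (x := x') (y := y')
    (fun k x => congrArg (fun K : E ≃ₜ E => K x) (hFH.zpow_zpow k n).eq)
    (by simp [x', hu₂]; linarith) (by simp [y', hu₂]; linarith)
    (by
      simp only [x', y', zpow_apply_add_smul hH₂, map_add, map_smul, hu₂, smul_eq_mul, mul_one]
      push_cast
      simp only [map_sub] at hxy
      linarith)
  exact ⟨C, fun n x y => hC n y x⟩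

end Abstract

end TorusHomeo

/-! ### Lifts: displacement and commutation -/

namespace TorusHomeo

lemma intVec_apply (m : Fin 2 → ℤ) (i : Fin 2) : intVec m i = m i := by
  fin_cases i <;> simp [intVec]

lemma continuous_proj : Continuous proj := by
  refine continuous_pi fun i => (AddCircle.continuous_mk' 1).comp ?_
  fun_prop

lemma proj_add_intVec (x : Plane) (m : Fin 2 → ℤ) : proj (x + intVec m) = proj x := by
  funext i
  simp only [proj, PiLp.add_apply, intVec_apply]
  rw [AddCircle.coe_add]
  have : ((m i : ℝ) : UnitAddCircle) = 0 := (AddCircle.coe_eq_zero_iff 1).2 ⟨m i, by simp⟩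
  rw [this, add_zero]

/-- Two maps to the plane with the same projection differ by a constant integer vector. -/
lemma exists_eq_add_intVec {A B : Plane → Plane} (hA : Continuous A) (hB : Continuous B)
    (h : ∀ x, proj (A x) = proj (B x)) : ∃ m : Fin 2 → ℤ, ∀ x, A x = B x + intVec m := by
  have hz : ∀ (i : Fin 2) (x : Plane), ((A x i - B x i : ℝ) : UnitAddCircle) = 0 := fun i x => by
    rw [AddCircle.coe_sub]
    exact sub_eq_zero.2 (congrFun (h x) i)
  have hconst : ∀ (i : Fin 2) (x y : Plane), A x i - B x i = A y i - B y i := fun i =>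
    (AddCircle.isCoveringMap_coe (1 : ℝ)).const_of_comp (g := fun x => A x i - B x i) (by fun_prop)
      fun x y => (hz i x).trans (hz i y).symm
  choose m hm using fun i => (AddCircle.coe_eq_zero_iff 1).1 (hz i 0)
  refine ⟨m, fun x => ?_⟩
  ext i
  have h1 := hm i
  rw [PiLp.add_apply, intVec_apply]
  simp only [zsmul_eq_mul, mul_one] at h1
  linarith [hconst i x 0]

/-- The displacement of a lift of an element of `Homeo₀(𝕋²)` is a continuous function on the
torus. -/
theorem exists_displacement {f : Torus ≃ₜ Torus} (hf : HomotopicToId f) {F : Plane ≃ₜ Plane}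
    (hF : IsLift F f) (i : Fin 2) : ∃ φ : C(Torus, ℝ), ∀ x, F x i = x i + φ (proj x) := by
  obtain ⟨K⟩ := hf.symm
  -- The circle-valued displacement along the homotopy starts at 0, so it lifts to a real function
  -- on the torus.
  let L : C(unitInterval × Torus, UnitAddCircle) := ⟨fun p => K p i - p.2 i, by fun_prop⟩
  have cov := AddCircle.isCoveringMap_coe (1 : ℝ)
  have hL0 : ∀ z, L (0, z) = (((ContinuousMap.const Torus (0 : ℝ)) z : ℝ) : UnitAddCircle) := by
    intro z
    simp [L]
  let φ := cov.liftHomotopy L (ContinuousMap.const Torus (0 : ℝ)) hL0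
  have hφ : ∀ z, ((φ (1, z) : ℝ) : UnitAddCircle) = f z i - z i := by
    intro z
    refine (congrFun (cov.liftHomotopy_lifts L (ContinuousMap.const Torus (0 : ℝ)) hL0) (1, z)).trans ?_
    simp [L]
  have hz : ∀ x, ((F x i - x i - φ (1, proj x) : ℝ) : UnitAddCircle) = 0 := by
    intro x
    rw [AddCircle.coe_sub, AddCircle.coe_sub, hφ, ← hF x]
    simp [proj]
  have hp := continuous_proj
  have hconst := cov.const_of_comp (g := fun x => F x i - x i - φ (1, proj x))
    (by have := F.continuous; fun_prop) fun x y => (hz x).trans (hz y).symm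
  refine ⟨⟨fun z => φ (1, z) + (F 0 i - (0 : Plane) i - φ (1, proj 0)), by fun_prop⟩, fun x => ?_⟩
  simp only [ContinuousMap.coe_mk]
  linarith [hconst x 0]

lemma IsLift.map_add_intVec {f : Torus ≃ₜ Torus} {F : Plane ≃ₜ Plane} (hF : IsLift F f)
    (hf : HomotopicToId f) (m : Fin 2 → ℤ) (x : Plane) : F (x + intVec m) = F x + intVec m := by
  ext i
  obtain ⟨φ, hφ⟩ := exists_displacement hf hF i
  rw [PiLp.add_apply, hφ, hφ, proj_add_intVec, PiLp.add_apply]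
  ring

lemma IsLift.exists_norm_sub_le {f : Torus ≃ₜ Torus} {F : Plane ≃ₜ Plane} (hF : IsLift F f)
    (hf : HomotopicToId f) : ∃ C, ∀ x, ‖F x - x‖ ≤ C := by
  choose φ hφ using exists_displacement hf hF
  let Φ : C(Torus, Plane) := ⟨fun z => WithLp.toLp 2 fun i => φ i z, by fun_prop⟩
  refine ⟨‖Φ‖, fun x => ?_⟩
  have : F x - x = Φ (proj x) := by
    ext i
    simp [Φ, hφ]
  rw [this]
  exact Φ.norm_coe_le_norm _

lemma norm_iterate_sub_le {E : Type*} [SeminormedAddCommGroup E] {A : E → E} {C : ℝ}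
    (hA : ∀ x, ‖A x - x‖ ≤ C) (n : ℕ) (x : E) : ‖A^[n] x - x‖ ≤ n * C := by
  induction n with
  | zero => simp
  | succ n ih =>
    rw [Function.iterate_succ_apply']
    calc ‖A (A^[n] x) - x‖ ≤ ‖A (A^[n] x) - A^[n] x‖ + ‖A^[n] x - x‖ := norm_sub_le_norm_sub_add_norm_sub ..
      _ ≤ C + n * C := add_le_add (hA _) ih
      _ = _ := by push_cast; ring

/-- If two maps at bounded distance from the identity commute up to a translation with which both
commute, then that translation is trivial. -/
lemma eq_zero_of_commute_up_to {E : Type*} [NormedAddCommGroup E] [NormedSpace ℝ E] {A B : E → E}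
    {c : E} {C D : ℝ} (hA : ∀ x, ‖A x - x‖ ≤ C) (hB : ∀ x, ‖B x - x‖ ≤ D)
    (hAc : ∀ x, A (x + c) = A x + c) (hBc : ∀ x, B (x + c) = B x + c)
    (hAB : ∀ x, A (B x) = B (A x) + c) : c = 0 := by
  have hBk : ∀ (k : ℕ) (x : E), B (x + k • c) = B x + k • c := by
    intro k
    induction k with
    | zero => simp
    | succ k ih => intro x; rw [succ_nsmul, ← add_assoc, hBc, ih, add_assoc]
  have h1 : ∀ (n : ℕ) (x : E), A^[n] (B x) = B (A^[n] x) + n • c := by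
    intro n
    induction n with
    | zero => simp
    | succ n ih =>
      intro x
      rw [Function.iterate_succ_apply, hAB, Function.iterate_succ_apply]
      have : ∀ (n : ℕ) (x : E), A^[n] (x + c) = A^[n] x + c := by
        intro n
        induction n with
        | zero => simp
        | succ n ih => intro x; rw [Function.iterate_succ_apply, hAc, ih, Function.iterate_succ_apply]
      rw [this, ih, succ_nsmul, add_assoc]
  have h2 : ∀ (n k : ℕ) (x : E), A^[n] (B^[k] x) = B^[k] (A^[n] x) + (k * n) • c := by
    intro n k
    induction k with
    | zero => simp
    | succ k ih =>
      intro x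
      rw [Function.iterate_succ_apply', h1, ih, hBk, Function.iterate_succ_apply', add_assoc,
        ← add_nsmul, Nat.succ_mul]
  -- Commuting `n` copies of each map produces `n * n` copies of `c`, but the displacements involved
  -- grow only linearly in `n`.
  have h3 : ∀ n : ℕ, (n : ℝ) * ‖c‖ ≤ 2 * (C + D) := by
    intro n
    rcases n.eq_zero_or_pos with rfl | hn
    · have := (norm_nonneg _).trans (hA 0)
      have := (norm_nonneg _).trans (hB 0)
      simp only [Nat.cast_zero, zero_mul]
      positivity
    have hn' : (0 : ℝ) < n := by exact_mod_cast hn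
    have h := h2 n n 0
    have e : (n * n) • c = (A^[n] (B^[n] 0) - B^[n] 0) + (B^[n] 0 - 0)
        - ((B^[n] (A^[n] 0) - A^[n] 0) + (A^[n] 0 - 0)) := by
      rw [h]
      abel
    have b1 := norm_iterate_sub_le hA n (B^[n] 0)
    have b2 := norm_iterate_sub_le hB n 0
    have b3 := norm_iterate_sub_le hB n (A^[n] 0)
    have b4 := norm_iterate_sub_le hA n 0
    have h5 : ‖(n * n) • c‖ ≤ n * C + n * D + (n * D + n * C) := by
      rw [e]
      exact (norm_sub_le _ _).trans (add_le_add (norm_add_le_of_le b1 b2) (norm_add_le_of_le b3 b4))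
    rw [← Nat.cast_smul_eq_nsmul ℝ, norm_smul, Real.norm_natCast] at h5
    push_cast at h5
    refine le_of_mul_le_mul_left ?_ hn'
    linarith
  by_contra hc
  obtain ⟨n, hn⟩ := exists_nat_gt (2 * (C + D) / ‖c‖)
  rw [div_lt_iff₀ (norm_pos_iff.2 hc)] at hn
  linarith [h3 n]

/-- Lifts of commuting elements of `Homeo₀(𝕋²)` commute. -/
theorem IsLift.commute {f h : Torus ≃ₜ Torus} {F H : Plane ≃ₜ Plane} (hF : IsLift F f)
    (hH : IsLift H h) (hf : HomotopicToId f) (hh : HomotopicToId h)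
    (hfh : ∀ z, f (h z) = h (f z)) : Commute F H := by
  obtain ⟨m, hm⟩ := exists_eq_add_intVec (F.continuous.comp H.continuous)
    (H.continuous.comp F.continuous) fun x => by
      simp only [Function.comp_apply]
      rw [hF, hH, hH, hF, hfh]
  obtain ⟨C, hC⟩ := hF.exists_norm_sub_le hf
  obtain ⟨D, hD⟩ := hH.exists_norm_sub_le hh
  have h0 := eq_zero_of_commute_up_to hC hD (hF.map_add_intVec hf m) (hH.map_add_intVec hh m) hm
  refine Homeomorph.ext fun x => ?_
  simpa [h0] using hm x

end TorusHomeo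

/-! ### Bounded deviation and the rotation set -/

namespace TorusHomeo

open Filter Topology

lemma disp_add (F : Plane ≃ₜ Plane) (m n : ℤ) (x : Plane) :
    disp F (m + n) x = disp F m ((F ^ n) x) + disp F n x := by
  simp only [disp]
  rw [zpow_add, Homeomorph.mul_apply]
  abel

lemma norm_disp_mul_sub_le {F : Plane ≃ₜ Plane} {C : ℝ}
    (hC : ∀ (n : ℤ) (x y : Plane), ‖disp F n x - disp F n y‖ ≤ C) (k : ℕ) (m : ℤ) (x y : Plane) :
    ‖disp F (k * m) x - (k : ℝ) • disp F m y‖ ≤ k * C := by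
  induction k with
  | zero => simp [disp]
  | succ k ih =>
    have e : disp F ((k + 1 : ℕ) * m) x - ((k + 1 : ℕ) : ℝ) • disp F m y =
        (disp F m ((F ^ (k * m : ℤ)) x) - disp F m y) +
          (disp F (k * m) x - (k : ℝ) • disp F m y) := by
      have : (((k + 1 : ℕ) : ℤ) * m) = m + k * m := by push_cast; ring
      rw [this, disp_add]
      push_cast
      module
    rw [e]
    calc _ ≤ C + k * C := norm_add_le_of_le (hC _ _ _) ih
      _ = _ := by push_cast; ring

/-- Both averages are compared with that of the common iterate `m * n`. -/
lemma norm_average_sub_le {F : Plane ≃ₜ Plane} {C : ℝ}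
    (hC : ∀ (n : ℤ) (x y : Plane), ‖disp F n x - disp F n y‖ ≤ C) {n m : ℕ} (hn : 0 < n)
    (hm : 0 < m) (x y : Plane) :
    ‖(n : ℝ)⁻¹ • disp F n x - (m : ℝ)⁻¹ • disp F m y‖ ≤ C / n + C / m := by
  have hn' : (0 : ℝ) < n := by exact_mod_cast hn
  have hm' : (0 : ℝ) < m := by exact_mod_cast hm
  have h1 := norm_disp_mul_sub_le hC m n x x
  have h2 := norm_disp_mul_sub_le hC n m x y
  rw [mul_comm (n : ℤ)] at h2
  have e : (n : ℝ)⁻¹ • disp F n x - (m : ℝ)⁻¹ • disp F m y = ((n : ℝ)⁻¹ * (m : ℝ)⁻¹) •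
      ((disp F (m * n) x - (n : ℝ) • disp F m y) - (disp F (m * n) x - (m : ℝ) • disp F n x)) := by
    match_scalars <;> field_simp
    ring
  rw [e, norm_smul, Real.norm_of_nonneg (by positivity)]
  calc _ ≤ ((n : ℝ)⁻¹ * (m : ℝ)⁻¹) * (n * C + m * C) := by
        gcongr
        exact (norm_sub_le _ _).trans (add_le_add h2 h1)
    _ = _ := by field_simp; ring

/-- A homeomorphism of bounded deviation is a pseudo-rotation. -/
theorem isPseudoRotation_of_norm_disp_sub_le {F : Plane ≃ₜ Plane} {C : ℝ}
    (hC : ∀ (n : ℤ) (x y : Plane), ‖disp F n x - disp F n y‖ ≤ C) : IsPseudoRotation F := by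
  have hC0 : 0 ≤ C := (norm_nonneg _).trans (hC 0 0 0)
  let a : ℕ → Plane := fun n => ((n + 1 : ℕ) : ℝ)⁻¹ • disp F (n + 1 : ℕ) 0
  have hlim : ∀ c : ℝ, Tendsto (fun n : ℕ => c / ((n + 1 : ℕ) : ℝ)) atTop (𝓝 0) := fun c =>
    (tendsto_const_div_atTop_nhds_zero_nat c).comp (tendsto_add_atTop_nat 1)
  have ha : CauchySeq a := by
    refine cauchySeq_of_le_tendsto_0 (fun N : ℕ => 2 * C / ((N + 1 : ℕ) : ℝ)) (fun n m N hn hm => ?_)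
      (hlim _)
    rw [dist_eq_norm]
    refine (norm_average_sub_le hC n.succ_pos m.succ_pos 0 0).trans ?_
    rw [two_mul, add_div]
    gcongr <;> exact Nat.succ_le_succ ‹_›
  obtain ⟨p, hp⟩ := cauchySeq_tendsto_of_complete ha
  have hbound : ∀ (n : ℤ) (x : Plane), 0 < n → ‖(n : ℝ)⁻¹ • disp F n x - p‖ ≤ C / n := by
    intro n x hn
    lift n to ℕ using hn.le
    have hn' : 0 < n := by exact_mod_cast hn
    have h1 : Tendsto (fun m => ‖(n : ℝ)⁻¹ • disp F n x - a m‖) atTop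
        (𝓝 ‖(n : ℝ)⁻¹ • disp F n x - p‖) := (tendsto_const_nhds.sub hp).norm
    have h2 := (tendsto_const_nhds (x := C / (n : ℝ))).add (hlim C)
    rw [add_zero] at h2
    simpa using le_of_tendsto_of_tendsto' h1 h2 fun m => norm_average_sub_le hC hn' m.succ_pos x 0
  have htend : ∀ (n : ℕ → ℤ) (x : ℕ → Plane), Tendsto n atTop atTop →
      Tendsto (fun i => ((n i : ℝ)⁻¹) • disp F (n i) (x i)) atTop (𝓝 p) := by
    intro n x hn
    rw [tendsto_iff_norm_sub_tendsto_zero]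
    have h0 : Tendsto (fun i => C / (n i : ℝ)) atTop (𝓝 0) :=
      tendsto_const_nhds.div_atTop (tendsto_intCast_atTop_atTop.comp hn)
    refine squeeze_zero' (Eventually.of_forall fun _ => norm_nonneg _) ?_ h0
    filter_upwards [hn.eventually_gt_atTop 0] with i hi using hbound _ _ hi
  refine ⟨p, Set.eq_singleton_iff_unique_mem.2 ⟨?_, ?_⟩⟩
  · exact ⟨fun i => i, fun _ => 0, tendsto_natCast_atTop_atTop,
      htend _ _ tendsto_natCast_atTop_atTop⟩
  · rintro q ⟨n, x, hn, hq⟩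
    exact tendsto_nhds_unique hq (htend n x hn)

lemma enorm_le_ofReal {E : Type*} [SeminormedAddGroup E] {x : E} {C : ℝ} (h : ‖x‖ ≤ C) :
    ‖x‖ₑ ≤ ENNReal.ofReal C := by
  rw [← ofReal_norm]
  exact ENNReal.ofReal_le_ofReal h

lemma deviation_lt_top {F : Plane ≃ₜ Plane} {C : ℝ}
    (hC : ∀ (n : ℤ) (x y : Plane), ‖disp F n x - disp F n y‖ ≤ C) : deviation F < ⊤ :=
  (iSup_le fun n => iSup_le fun x => iSup_le fun y =>
    enorm_le_ofReal (hC n x y)).trans_lt ENNReal.ofReal_lt_top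

lemma deviationIn_lt_top {F : Plane ≃ₜ Plane} {w : Plane} {C : ℝ}
    (hC : ∀ (n : ℤ) (x y : Plane), |scalarProj w (disp F n x - disp F n y)| ≤ C) :
    deviationIn w F < ⊤ :=
  (iSup_le fun n => iSup_le fun x => iSup_le fun y =>
    enorm_le_ofReal (hC n x y)).trans_lt ENNReal.ofReal_lt_top

lemma perp_intVec (v : Fin 2 → ℤ) : perp (intVec v) = intVec ![-v 1, v 0] := by
  ext i
  fin_cases i <;> simp [perp, intVec]

lemma inner_eq_coords (x y : Plane) : inner ℝ x y = x 0 * y 0 + x 1 * y 1 := by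
  simp [PiLp.inner_apply, Fin.sum_univ_two, mul_comm]

lemma norm_perp (w : Plane) : ‖perp w‖ = ‖w‖ := by
  rw [EuclideanSpace.norm_eq, EuclideanSpace.norm_eq]
  simp [Fin.sum_univ_two, perp, add_comm]

lemma inner_perp_self (w : Plane) : inner ℝ w (perp w) = 0 := by
  rw [inner_eq_coords]
  simp [perp]
  ring

lemma eq_smul_add_smul_perp {w : Plane} (hw : w ≠ 0) (x : Plane) :
    x = (inner ℝ w x / ‖w‖ ^ 2) • w + (inner ℝ (perp w) x / ‖w‖ ^ 2) • perp w := by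
  have hN : ‖w‖ ^ 2 = w 0 ^ 2 + w 1 ^ 2 := by
    rw [← real_inner_self_eq_norm_sq, inner_eq_coords, sq, sq]
  have hN0 : w 0 ^ 2 + w 1 ^ 2 ≠ 0 := by
    rw [← hN]
    exact pow_ne_zero 2 (norm_ne_zero_iff.2 hw)
  rw [hN]
  ext i
  fin_cases i <;> simp [inner_eq_coords, perp] <;> field_simp <;> ring

end TorusHomeo

/-! ### Reduction to the abstract dichotomy -/

theorem theoremB (f h : TorusHomeo.Torus ≃ₜ TorusHomeo.Torus)
    (hf : TorusHomeo.HomotopicToId f) (hh : TorusHomeo.HomotopicToId h)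
    (hfh : ∀ z : TorusHomeo.Torus, f (h z) = h (f z))
    (F H : TorusHomeo.Plane ≃ₜ TorusHomeo.Plane)
    (hF : TorusHomeo.IsLift F f) (hH : TorusHomeo.IsLift H h)
    (v : Fin 2 → ℤ) (hv : v ≠ 0)
    (hann : TorusHomeo.IsAnnular (TorusHomeo.intVec v) F) :
    TorusHomeo.deviationIn (TorusHomeo.perp (TorusHomeo.intVec v)) H < ⊤ ∨
      (TorusHomeo.deviation F < ⊤ ∧ TorusHomeo.IsPseudoRotation F) := by
  open TorusHomeo in
  obtain ⟨M, hM⟩ := hann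
  set w := intVec v with hw
  have hw0 : w ≠ 0 := by
    contrapose! hv
    funext i
    have := intVec_apply v i
    rw [← hw, hv, PiLp.zero_apply] at this
    simpa using this.symm
  have hN : 0 < ‖w‖ := norm_pos_iff.2 hw0
  have hN2 : ‖w‖ ^ 2 ≠ 0 := by positivity
  -- Coordinates in the basis `w`, `perp w`. Both vectors are integral, so the lifts commute with
  -- these translations; they need not generate ℤ².
  let s : Plane →L[ℝ] ℝ := (‖w‖ ^ 2)⁻¹ • innerSL ℝ w
  let u : Plane →L[ℝ] ℝ := (‖w‖ ^ 2)⁻¹ • innerSL ℝ (perp w)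
  have hs : ∀ x, s x = inner ℝ w x / ‖w‖ ^ 2 := fun x => by simp [s]; ring
  have hu : ∀ x, u x = inner ℝ (perp w) x / ‖w‖ ^ 2 := fun x => by simp [u]; ring
  have hdec : ∀ x, x = s x • w + u x • perp w := fun x => by
    rw [hs, hu]
    exact eq_smul_add_smul_perp hw0 x
  have hs₁ : s w = 1 := by rw [hs, real_inner_self_eq_norm_sq, div_self hN2]
  have hs₂ : s (perp w) = 0 := by rw [hs, inner_perp_self, zero_div]
  have hu₁ : u w = 0 := by rw [hu, real_inner_comm, inner_perp_self, zero_div]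
  have hu₂ : u (perp w) = 1 := by rw [hu, real_inner_self_eq_norm_sq, norm_perp, div_self hN2]
  have hinj : ∀ x y, s x = s y → u x = u y → x = y := fun x y h1 h2 => by
    rw [hdec x, hdec y, h1, h2]
  have huM : ∀ (n : ℤ) (x : Plane), |u ((F ^ n) x - x)| ≤ M / ‖w‖ ^ 2 := fun n x => by
    rw [hu, abs_div, abs_of_nonneg (sq_nonneg ‖w‖), real_inner_comm]
    gcongr
    exact hM n x
  have hperp : ∀ {g : Torus ≃ₜ Torus} {G : Plane ≃ₜ Plane}, IsLift G g → HomotopicToId g →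
      ∀ x, G (x + perp w) = G x + perp w := fun hG hg x => by
    rw [hw, perp_intVec]
    exact hG.map_add_intVec hg _ x
  refine (vertical_or_horizontal_deviation_bounded hs₁ hs₂ hu₁ hu₂ hinj (hF.map_add_intVec hf v)
    (hperp hF hf) huM (hH.map_add_intVec hh v) (hperp hH hh) (hF.commute hH hf hh hfh)).imp ?_ ?_
  · rintro ⟨L, hL⟩
    refine deviationIn_lt_top (C := L * ‖w‖) fun n x y => ?_
    have h1 : |u (disp H n x - disp H n y)| ≤ L := by
      rw [map_sub]
      exact abs_sub_le_iff.2 ⟨hL n x y, hL n y x⟩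
    have h2 : scalarProj (perp w) (disp H n x - disp H n y) =
        u (disp H n x - disp H n y) * ‖w‖ := by
      rw [scalarProj, hu, norm_perp, real_inner_comm]
      field_simp
    rw [h2, abs_mul, abs_norm]
    gcongr
  · rintro ⟨C, hC⟩
    have hbound : ∀ (n : ℤ) (x y : Plane),
        ‖disp F n x - disp F n y‖ ≤ C * ‖w‖ + 2 * (M / ‖w‖ ^ 2) * ‖w‖ := by
      intro n x y
      have h1 : |s (disp F n x - disp F n y)| ≤ C := by
        rw [map_sub]
        exact abs_sub_le_iff.2 ⟨hC n x y, hC n y x⟩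
      have h2 : |u (disp F n x - disp F n y)| ≤ 2 * (M / ‖w‖ ^ 2) := by
        rw [map_sub, two_mul]
        exact (abs_sub _ _).trans (add_le_add (huM n x) (huM n y))
      rw [hdec (disp F n x - disp F n y)]
      refine norm_add_le_of_le ?_ ?_
      · rw [norm_smul, Real.norm_eq_abs]
        gcongr
      · rw [norm_smul, Real.norm_eq_abs, norm_perp]
        gcongr
    exact ⟨deviation_lt_top hbound, isPseudoRotation_of_norm_disp_sub_le hbound⟩
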